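/- Let $G$ be a (smooth, finite-dimensional, real) Lie group with identity element $e$ and Lie algebra $\mathfrak g = T_eG$ (bracket of left-invariant vector fields). Let $R_g$ denote right translation by $g$. For $r\in\Lambda^2\mathfrak g$ and a linear map $n:\mathfrak g\to\mathfrak g$ let $\overrightarrow r$ and $\overrightarrow n$ be the right-invariant bivector field and $(1,1)$-tensor field $\overrightarrow r(g)=(T_eR_g)(r)$ and $\overrightarrow n(g)=T_eR_g\circ n\circ T_gR_{g^{-1}}$. A Poisson–Nijenhuis structure on a manifold $M$ is a pair $(\Pi,N)$ of a smooth bivector field $\Pi$ and a smooth $(1,1)$-tensor field $N$ such that: $[\Pi,\Pi]=0$ for the Schouten–Nijenhuis bracket; $[NX,NY]-N[NX,Y]-N[X,NY]+N^2[X,Y]=0$ for all vector fields $X,Y$; $N\circ\Pi^\sharp=\Pi^\sharp\circ N^t$, where $\langle\alpha,\Pi^\sharp\beta\rangle=\Pi(\alpha,\beta)$; and, for all $1$-forms $\alpha,\beta$, $$C(\Pi,N)(\alpha,\beta)=\mathcal L_{\Pi^\sharp\alpha}(N^t\beta)-\mathcal L_{\Pi^\sharp\beta}(N^t\alpha)+N^t\mathcal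 L_{\Pi^\sharp\beta}\alpha-N^t\mathcal L_{\Pi^\sharp\alpha}\beta+d\langle\alpha,N\Pi^\sharp\beta\rangle-N^td\langle\alpha,\Pi^\sharp\beta\rangle=0.$$ A Poisson–Nijenhuis structure $(\Pi,N)$ on $G$ is right-invariant if $\Pi=\overrightarrow r$ and $N=\overrightarrow n$ for some $r\in\Lambda^2\mathfrak g$ and some linear $n:\mathfrak g\to\mathfrak g$. An r-n structure on a finite-dimensional real Lie algebra $\mathfrak g$ is a pair $(r,n)$ of an element $r\in\Lambda^2\mathfrak g$ and a linear map $n:\mathfrak g\to\mathfrak g$ such that (i) $r$ solves the classical Yang–Baxter equation: $[\![r,r]\!]=0$ for the algebraic Schouten bracket; (ii) $[nX,nY]-n[nX,Y]-n[X,nY]+n^2[X,Y]=0$ for all $X,Y\in\mathfrak g$; (iii) $n\circ r^\sharp=r^\sharp\circ n^t$, where $r^\sharp:\mathfrak g^*\to\mathfrak g$ is given by $\langle\alpha,r^\sharp\beta\rangle=r(\alpha,\beta)$; (iv) for all $\alpha,\beta\in\mathfrak g^*$, $$C(r,n)(\alpha,\beta)=ad^*_{r^\sharp\alpha}n^t\beta-ad^*_{r^\sharp\beta}n^t\alpha-n^tad^*_{r^\sharp\alpha}\beta+n^tad^*_{r^\sharp\beta}\alpha=0,$$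 where $ad^*_X=-(ad_X)^t$. **Proposition.** If $(\Pi,N)$ is a right-invariant Poisson–Nijenhuis structure on $G$, then the pair $(r,n)=(\Pi(e),N|_{T_eG})$ is an r-n structure on the Lie algebra of $G$. Conversely, let $(r,n)$ be an r-n structure on a finite-dimensional real Lie algebra $\mathfrak g$. If $G$ is a Lie group whose Lie algebra is (identified by an isomorphism with) $\mathfrak g$, then $(\overrightarrow r,\overrightarrow n)$ is a right-invariant Poisson–Nijenhuis structure on $G$. -/

import Mathlib

open scoped Manifold ContDiff
open Set VectorField

noncomputable section

namespace PNGroup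

/-! ### Linear algebra of 2-vectors -/

section Linear

variable {V W : Type*} [AddCommGroup V] [Module ℝ V] [AddCommGroup W] [Module ℝ W]

/-- Contravariant 2-tensors on a finite-dimensional space `V`, as bilinear forms on `V*`.
The elements of `Λ² V` are the alternating ones (`LinearMap.IsAlt`), where
`(X ∧ Y) (α, β) = α X * β Y - α Y * β X`. -/
abbrev Tensor2 (V : Type*) [AddCommGroup V] [Module ℝ V] : Type _ :=
  LinearMap.BilinForm ℝ (Module.Dual ℝ V)

/-- The map induced on contravariant 2-tensors by a linear map `f : V → W`,
`(f_* r) (α, β) = r (α ∘ f, β ∘ f)`. -/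
def Tensor2.map (f : V →ₗ[ℝ] W) (r : Tensor2 V) : Tensor2 W :=
  r.compl₁₂ f.dualMap f.dualMap

/-- The map `r^♯ : V* → V` with `⟨α, r^♯ β⟩ = r (α, β)`; see `apply_sharp`. -/
def Tensor2.sharp [FiniteDimensional ℝ V] (r : Tensor2 V) : Module.Dual ℝ V →ₗ[ℝ] V :=
  (Module.evalEquiv ℝ V).symm.toLinearMap ∘ₗ r.flip

theorem Tensor2.apply_sharp [FiniteDimensional ℝ V] (r : Tensor2 V) (α β : Module.Dual ℝ V) :
    α (r.sharp β) = r α β := by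
  simp [Tensor2.sharp]

end Linear

/-! ### r-n structures on a Lie algebra -/

section Algebra

variable {𝔤 : Type*} [LieRing 𝔤] [LieAlgebra ℝ 𝔤]

/-- The coadjoint action `ad*_X = -(ad_X)ᵗ` on `𝔤*`. -/
def coad (X : 𝔤) : Module.Dual ℝ 𝔤 →ₗ[ℝ] Module.Dual ℝ 𝔤 :=
  -(LieAlgebra.ad ℝ 𝔤 X).dualMap

/-- The algebraic Schouten bracket of `r, s ∈ Λ² 𝔤`, a 3-vector on `𝔤`. It is the symmetric
bilinear extension of
`⟦X₁ ∧ X₂, Y₁ ∧ Y₂⟧ = ∑ i j, (-1)^(i+j) [Xᵢ, Yⱼ] ∧ X_{3-i} ∧ Y_{3-j}`. -/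
def algSchouten [FiniteDimensional ℝ 𝔤] (r s : Tensor2 𝔤) (α β γ : Module.Dual ℝ 𝔤) : ℝ :=
  (γ ⁅r.sharp α, s.sharp β⁆ + γ ⁅s.sharp α, r.sharp β⁆)
    + (α ⁅r.sharp β, s.sharp γ⁆ + α ⁅s.sharp β, r.sharp γ⁆)
    + (β ⁅r.sharp γ, s.sharp α⁆ + β ⁅s.sharp γ, r.sharp α⁆)

/-- The classical Yang-Baxter equation `⟦r, r⟧ = 0`. -/
def IsCYBE [FiniteDimensional ℝ 𝔤] (r : Tensor2 𝔤) : Prop :=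
  ∀ α β γ : Module.Dual ℝ 𝔤, algSchouten r r α β γ = 0

/-- The Nijenhuis torsion `[n, n]` of an endomorphism of a Lie algebra. -/
def algTorsion (n : Module.End ℝ 𝔤) (X Y : 𝔤) : 𝔤 :=
  ⁅n X, n Y⁆ - n ⁅n X, Y⁆ - n ⁅X, n Y⁆ + n (n ⁅X, Y⁆)

/-- The algebraic concomitant `C(r, n)`. -/
def algConcomitant [FiniteDimensional ℝ 𝔤] (r : Tensor2 𝔤) (n : Module.End ℝ 𝔤)
    (α β : Module.Dual ℝ 𝔤) : Module.Dual ℝ 𝔤 :=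
  coad (r.sharp α) (n.dualMap β) - coad (r.sharp β) (n.dualMap α)
    - n.dualMap (coad (r.sharp α) β) + n.dualMap (coad (r.sharp β) α)

/-- `(r, n)` is an r-n structure on the finite-dimensional real Lie algebra `𝔤`. -/
structure IsRNStructure [FiniteDimensional ℝ 𝔤] (r : Tensor2 𝔤) (n : Module.End ℝ 𝔤) : Prop where
  alt : r.IsAlt
  cybe : IsCYBE r
  torsion : ∀ X Y : 𝔤, algTorsion n X Y = 0
  comp_sharp : n ∘ₗ r.sharp = r.sharp ∘ₗ n.dualMap
  concomitant : ∀ α β : Module.Dual ℝ 𝔤, algConcomitant r n α β = 0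

end Algebra

/-! ### Poisson-Nijenhuis structures on a manifold -/

section Manifold

variable {E : Type*} [NormedAddCommGroup E] [NormedSpace ℝ E]
  {H : Type*} [TopologicalSpace H] (I : ModelWithCorners ℝ E H)
  {M : Type*} [TopologicalSpace M] [ChartedSpace H M]

instance instFiniteDimensionalTangentSpace [FiniteDimensional ℝ E] (x : M) :
    FiniteDimensional ℝ (TangentSpace I x) :=
  inferInstanceAs (FiniteDimensional ℝ E)

variable (M) in
/-- (Not necessarily smooth) vector fields. -/
abbrev VecField : Type _ := (x : M) → TangentSpace I x

variable (M) in
/-- (Not necessarily smooth) 1-forms. -/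
abbrev OneForm : Type _ := (x : M) → Module.Dual ℝ (TangentSpace I x)

variable (M) in
/-- (Not necessarily smooth) contravariant 2-tensor fields. -/
abbrev Tensor2Field : Type _ := (x : M) → Tensor2 (TangentSpace I x)

variable (M) in
/-- (Not necessarily smooth) (1,1)-tensor fields. -/
abbrev EndField : Type _ := (x : M) → Module.End ℝ (TangentSpace I x)

/-- A vector field is smooth at `x`. -/
def SmoothVecAt [IsManifold I ∞ M] (X : VecField I M) (x : M) : Prop :=
  ContMDiffAt I I.tangent ∞ (fun y ↦ (X y : TangentBundle I M)) x

/-- A 1-form is smooth at `x`: its values on vector fields smooth at `x` are smooth at `x`. -/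
def SmoothFormAt [IsManifold I ∞ M] (α : OneForm I M) (x : M) : Prop :=
  ∀ X : VecField I M, SmoothVecAt I X x → ContMDiffAt I 𝓘(ℝ, ℝ) ∞ (fun y ↦ α y (X y)) x

/-- A contravariant 2-tensor field is smooth: its values on locally smooth 1-forms are smooth. -/
def SmoothTensor2 [IsManifold I ∞ M] (P : Tensor2Field I M) : Prop :=
  ∀ (x : M) (α β : OneForm I M), SmoothFormAt I α x → SmoothFormAt I β x →
    ContMDiffAt I 𝓘(ℝ, ℝ) ∞ (fun y ↦ P y (α y) (β y)) x

/-- A (1,1)-tensor field is smooth: its values on locally smooth vector fields are smooth. -/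
def SmoothEnd [IsManifold I ∞ M] (N : EndField I M) : Prop :=
  ∀ (x : M) (X : VecField I M), SmoothVecAt I X x → SmoothVecAt I (fun y ↦ N y (X y)) x

/-- The derivative `X f` of a function along a vector field. -/
def dirDeriv (X : VecField I M) (f : M → ℝ) (x : M) : ℝ :=
  mvfderiv I f x (X x)

/-- The Lie derivative of a 1-form, evaluated on a vector field:
`(ℒ_X α) (Y) = X (α Y) - α [X, Y]`. -/
def lieDerivForm (X : VecField I M) (α : OneForm I M) (Y : VecField I M) (x : M) : ℝ :=
  dirDeriv I X (fun y ↦ α y (Y y)) x - α x (mlieBracket I X Y x)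

/-- The Nijenhuis torsion `[N, N]` of a (1,1)-tensor field. -/
def torsion (N : EndField I M) (X Y : VecField I M) (x : M) : TangentSpace I x :=
  mlieBracket I (fun y ↦ N y (X y)) (fun y ↦ N y (Y y)) x
    - N x (mlieBracket I (fun y ↦ N y (X y)) Y x)
    - N x (mlieBracket I X (fun y ↦ N y (Y y)) x)
    + N x (N x (mlieBracket I X Y x))

/-- The Schouten-Nijenhuis bracket of two bivector fields `P`, `Q` on a subset `s` of a vector
space, evaluated at `y` on three covectors. In linear coordinates, with `P^{ab} = P (e^a, e^b)`,
`[P, Q]^{ijk} = ∑ l, ∑ cyclic (i j k), (P^{il} ∂ₗ Q^{jk} + Q^{il} ∂ₗ P^{jk})`,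
the symmetric bracket which on decomposable bivector fields is
`[X₁ ∧ X₂, Y₁ ∧ Y₂] = ∑ i j, (-1)^(i+j) [Xᵢ, Yⱼ] ∧ X_{3-i} ∧ Y_{3-j}`. -/
def schoutenWithin [FiniteDimensional ℝ E] (P Q : E → Tensor2 E) (s : Set E) (y : E)
    (α β γ : Module.Dual ℝ E) : ℝ :=
  -((fderivWithin ℝ (fun z ↦ Q z β γ) s y ((P y).sharp α)
      + fderivWithin ℝ (fun z ↦ P z β γ) s y ((Q y).sharp α))
    + (fderivWithin ℝ (fun z ↦ Q z γ α) s y ((P y).sharp β)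
      + fderivWithin ℝ (fun z ↦ P z γ α) s y ((Q y).sharp β))
    + (fderivWithin ℝ (fun z ↦ Q z α β) s y ((P y).sharp γ)
      + fderivWithin ℝ (fun z ↦ P z α β) s y ((Q y).sharp γ)))

/-- The expression of a contravariant 2-tensor field in the preferred chart at `x₀`. -/
def tensor2InChart (P : Tensor2Field I M) (x₀ : M) (y : E) : Tensor2 E :=
  Tensor2.map
    (mfderivWithin 𝓘(ℝ, E) I (extChartAt I x₀).symm (range I) y).inverse.toLinearMap
    (P ((extChartAt I x₀).symm y))

/-- The Schouten-Nijenhuis bracket of two bivector fields on a manifold, a 3-vector field. Its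
value at `x` is computed in the preferred chart at `x` (just as `VectorField.mlieBracket`). -/
def schouten [FiniteDimensional ℝ E] (P Q : Tensor2Field I M) (x : M)
    (α β γ : Module.Dual ℝ (TangentSpace I x)) : ℝ :=
  let toChart : Module.Dual ℝ (TangentSpace I x) →ₗ[ℝ] Module.Dual ℝ E :=
    LinearMap.dualMap (mfderiv I 𝓘(ℝ, E) (extChartAt I x) x).inverse.toLinearMap
  schoutenWithin (tensor2InChart I P x) (tensor2InChart I Q x) (range I) (extChartAt I x x)
    (toChart α) (toChart β) (toChart γ)

/-- The vector field `P^♯ α`. -/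
def sharpField [FiniteDimensional ℝ E] (P : Tensor2Field I M) (α : OneForm I M) : VecField I M :=
  fun x ↦ (P x).sharp (α x)

/-- The 1-form `Nᵗ α`. -/
def transposeField (N : EndField I M) (α : OneForm I M) : OneForm I M :=
  fun x ↦ (N x).dualMap (α x)

/-- The concomitant `C(P, N)(α, β)`, a 1-form, evaluated on a vector field `Y`:
`C(P, N)(α, β) = ℒ_{P^♯ α} (Nᵗ β) - ℒ_{P^♯ β} (Nᵗ α) + Nᵗ ℒ_{P^♯ β} α - Nᵗ ℒ_{P^♯ α} β
  + d ⟨α, N P^♯ β⟩ - Nᵗ d ⟨α, P^♯ β⟩`. -/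
def concomitant [FiniteDimensional ℝ E] (P : Tensor2Field I M) (N : EndField I M)
    (α β : OneForm I M) (Y : VecField I M) (x : M) : ℝ :=
  let NY : VecField I M := fun y ↦ N y (Y y)
  lieDerivForm I (sharpField I P α) (transposeField I N β) Y x
    - lieDerivForm I (sharpField I P β) (transposeField I N α) Y x
    + lieDerivForm I (sharpField I P β) α NY x
    - lieDerivForm I (sharpField I P α) β NY x
    + dirDeriv I Y (fun y ↦ α y (N y (sharpField I P β y))) x
    - dirDeriv I NY (fun y ↦ α y (sharpField I P β y)) x

/-- `(P, N)` is a Poisson-Nijenhuis structure on the smooth manifold `M`. -/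
structure IsPoissonNijenhuis [FiniteDimensional ℝ E] [IsManifold I ∞ M]
    (P : Tensor2Field I M) (N : EndField I M) : Prop where
  alt : ∀ x, (P x).IsAlt
  smooth_bivector : SmoothTensor2 I P
  smooth_end : SmoothEnd I N
  poisson : ∀ (x : M) (α β γ : Module.Dual ℝ (TangentSpace I x)), schouten I P P x α β γ = 0
  nijenhuis : ∀ X Y : VecField I M, (∀ x, SmoothVecAt I X x) → (∀ x, SmoothVecAt I Y x) →
    ∀ x, torsion I N X Y x = 0
  comp_sharp : ∀ x, N x ∘ₗ (P x).sharp = (P x).sharp ∘ₗ (N x).dualMap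
  concomitant : ∀ α β : OneForm I M, (∀ x, SmoothFormAt I α x) → (∀ x, SmoothFormAt I β x) →
    ∀ Y : VecField I M, (∀ x, SmoothVecAt I Y x) → ∀ x, concomitant I P N α β Y x = 0

end Manifold

/-! ### Right-invariant structures on a Lie group -/

section Group

variable {E : Type*} [NormedAddCommGroup E] [NormedSpace ℝ E]
  {H : Type*} [TopologicalSpace H] (I : ModelWithCorners ℝ E H)
  {G : Type*} [TopologicalSpace G] [ChartedSpace H G] [Group G]

/-- The standing smoothness assumption of Mathlib's Lie bracket on `GroupLieAlgebra I G`. -/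
instance instLieGroupMinSmoothness [LieGroup I ∞ G] : LieGroup I (minSmoothness ℝ 3) G := by
  rw [minSmoothness_of_isRCLikeNormedField]
  infer_instance

instance instIsManifoldOfLieGroup [h : LieGroup I ∞ G] : IsManifold I ∞ G :=
  h.toContMDiffMul.toIsManifold

/-- `T_e R_g : 𝔤 → T_g G`, the tangent map at the identity of `R_g h = h * g`. -/
def rightTranslate (g : G) : GroupLieAlgebra I G →ₗ[ℝ] TangentSpace I g :=
  (mfderiv I I (fun h : G ↦ h * g) 1).toLinearMap

/-- `T_g R_{g⁻¹} : T_g G → 𝔤`. -/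
def rightTranslateInv (g : G) : TangentSpace I g →ₗ[ℝ] GroupLieAlgebra I G :=
  (mfderiv I I (fun h : G ↦ h * g⁻¹) g).toLinearMap

/-- The right-invariant contravariant 2-tensor field with value `r` at the identity. -/
def rightInvTensor2 (r : Tensor2 (GroupLieAlgebra I G)) : Tensor2Field I G :=
  fun g ↦ r.map (rightTranslate I g)

/-- The right-invariant (1,1)-tensor field `T_e R_g ∘ n ∘ T_g R_{g⁻¹}`. -/
def rightInvEnd (n : Module.End ℝ (GroupLieAlgebra I G)) : EndField I G :=
  fun g ↦ rightTranslate I g ∘ₗ n ∘ₗ rightTranslateInv I g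

/-- `(P, N)` is a right-invariant Poisson-Nijenhuis structure on the Lie group `G`. -/
structure IsRightInvariantPN [FiniteDimensional ℝ E] [LieGroup I ∞ G]
    (P : Tensor2Field I G) (N : EndField I G) : Prop where
  isPN : IsPoissonNijenhuis I P N
  bivector_rightInv : ∃ r : Tensor2 (GroupLieAlgebra I G), r.IsAlt ∧ P = rightInvTensor2 I r
  end_rightInv : ∃ n : Module.End ℝ (GroupLieAlgebra I G), N = rightInvEnd I n

end Group

end PNGroup

end

open scoped Manifold ContDiff
open Set VectorField

noncomputable section

/-! Right translations trivialize the tangent bundle as `G × 𝔤`: vector fields become functions `ξ :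
G → 𝔤`, 1-forms become functions `a : G → 𝔤*`, and the right-invariant tensors become the constants
`r` and `n`. If `X`, `Y` correspond to `ξ`, `η`, then `[X, Y]` corresponds to `Xη - Yξ - [ξ, η]`
(`mlieBracket_ofRightTriv`). The last sign is negative because the bracket of `𝔤` comes from
left-invariant fields, and inversion exchanges the left-invariant fields with minus the
right-invariant ones.

Substituted into the definitions, this leaves derivative terms and bracket terms. The derivative
terms cancel: in the torsion because `n` is constant, in the concomitant because `r^♯` and `n ∘ r^♯`
are both skew. The Schouten bracket is defined in a chart, where the bivector field has constant
coefficients `r` in the moving frame of right-invariant fields, so it reduces to Lie brackets of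
that frame.

Thus each differential obstruction at `g` is minus the right translate of its algebraic counterpart
(`torsion_rightInvEnd`, `concomitant_rightInv`, `schouten_rightInvTensor2`). If the algebraic ones
vanish, so do the differential ones at every `g`. In the other direction, evaluation at the identity
on right-invariant fields and forms recovers the algebraic ones. -/

namespace PNGroup

/-! ### Derivatives of self-maps, read in the model space -/

section ModelDeriv

variable {E : Type*} [NormedAddCommGroup E] [NormedSpace ℝ E]
  {H : Type*} [TopologicalSpace H] {I : ModelWithCorners ℝ E H}
  {G : Type*} [TopologicalSpace G] [ChartedSpace H G]

variable (I) in
/-- The derivative of a self-map of `G`, as an endomorphism of the model space. -/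
def modelDeriv (f : G → G) (x : G) : E →L[ℝ] E := mfderiv I I f x

/-- The chain rule with all tangent spaces read as `E`, so that equalities of base points and of
maps enter as hypotheses and need no casts. -/
theorem modelDeriv_comp {f g h : G → G} {x y : G} (hg : MDifferentiable I I g)
    (hf : MDifferentiable I I f) (hy : f x = y) (hh : ∀ z, g (f z) = h z) (v : E) :
    modelDeriv I g y (modelDeriv I f x v) = modelDeriv I h x v := by
  subst hy
  obtain rfl : g ∘ f = h := funext hh
  exact (DFunLike.congr_fun (mfderiv_comp x (hg _) (hf x)) v).symm

theorem modelDeriv_id (x : G) (v : E) : modelDeriv I (fun y : G ↦ y) x v = v :=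
  DFunLike.congr_fun (mfderiv_id (I := I) (x := x)) v

end ModelDeriv

/-! ### Right-invariant vector fields and their brackets -/

section RightInvariant

variable {E : Type*} [NormedAddCommGroup E] [NormedSpace ℝ E]
  {H : Type*} [TopologicalSpace H] {I : ModelWithCorners ℝ E H}
  {G : Type*} [TopologicalSpace G] [ChartedSpace H G] [Group G]

variable (I) in
/-- The right-invariant vector field with value `v` at the identity. -/
def rightInvField (v : GroupLieAlgebra I G) : VecField I G :=
  fun g ↦ rightTranslate I g v

theorem rightTranslate_one (v : GroupLieAlgebra I G) : rightTranslate I (1 : G) v = v := by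
  have h : (fun h : G ↦ h * 1) = fun h ↦ h := by ext; simp
  change modelDeriv I (fun h : G ↦ h * 1) 1 (id v : E) = _
  rw [h]
  exact modelDeriv_id (E := E) 1 v

variable [LieGroup I ∞ G]

theorem mdifferentiable_mul_right (g : G) : MDifferentiable I I (fun h : G ↦ h * g) :=
  (contMDiff_mul_right (I := I) (n := ∞)).mdifferentiable (by simp)

theorem mdifferentiable_mul_left (g : G) : MDifferentiable I I (fun h : G ↦ g * h) :=
  (contMDiff_mul_left (I := I) (n := ∞)).mdifferentiable (by simp)

theorem mdifferentiable_inv : MDifferentiable I I (fun h : G ↦ h⁻¹) :=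
  (contMDiff_inv I ∞).mdifferentiable (by simp)

theorem rightTranslateInv_rightTranslate (g : G) (v : GroupLieAlgebra I G) :
    rightTranslateInv I g (rightTranslate I g v) = v :=
  (modelDeriv_comp (E := E) (mdifferentiable_mul_right g⁻¹) (mdifferentiable_mul_right g)
    (one_mul g) (h := fun h ↦ h) (fun z ↦ by simp) v).trans (modelDeriv_id (E := E) 1 v)

theorem rightTranslate_rightTranslateInv (g : G) (v : TangentSpace I g) :
    rightTranslate I g (rightTranslateInv I g v) = v :=
  (modelDeriv_comp (E := E) (mdifferentiable_mul_right g) (mdifferentiable_mul_right g⁻¹)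
    (mul_inv_cancel g) (h := fun h ↦ h) (fun z ↦ by simp) v).trans (modelDeriv_id (E := E) g v)

theorem rightTranslateInv_one (v : GroupLieAlgebra I G) : rightTranslateInv I (1 : G) v = v := by
  have := rightTranslateInv_rightTranslate (1 : G) v
  rwa [rightTranslate_one] at this

/-- The field is the tangent map of multiplication applied to `v` at `1` paired with the zero vector
at `g`. -/
theorem smoothVecAt_rightInvField (v : GroupLieAlgebra I G) (g : G) :
    SmoothVecAt I (rightInvField I v) g := by
  let fg : G → TangentBundle I G := fun g ↦ Bundle.TotalSpace.mk' E g 0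
  have sfg : ContMDiff I I.tangent ∞ fg := Bundle.contMDiff_zeroSection _ _
  let fv : G → TangentBundle I G := fun _ ↦ Bundle.TotalSpace.mk' E 1 v
  have sfv : ContMDiff I I.tangent ∞ fv := contMDiff_const
  let F₁ : G → (TangentBundle I G × TangentBundle I G) := fun g ↦ (fv g, fg g)
  have S₁ : ContMDiff I (I.tangent.prod I.tangent) ∞ F₁ := sfv.prodMk sfg
  let F₂ : (TangentBundle I G × TangentBundle I G) → TangentBundle (I.prod I) (G × G) :=
    (equivTangentBundleProd I G I G).symm
  have S₂ : ContMDiff (I.tangent.prod I.tangent) (I.prod I).tangent ∞ F₂ :=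
    contMDiff_equivTangentBundleProd_symm
  let F₃ : TangentBundle (I.prod I) (G × G) → TangentBundle I G :=
    tangentMap (I.prod I) I (fun (p : G × G) ↦ p.1 * p.2)
  have S₃ : ContMDiff (I.prod I).tangent I.tangent ∞ F₃ :=
    ContMDiff.contMDiff_tangentMap (contMDiff_mul I ∞) (by simp)
  have S := ((S₃.comp S₂).comp S₁) g
  unfold SmoothVecAt
  convert! S with g
  · simp [F₁, F₂, F₃, fg, fv]
  · simp only [Function.comp_apply, tangentMap, F₃, F₂, F₁, fg, fv]
    rw [mfderiv_prod_eq_add_apply ((contMDiff_mul I ∞).mdifferentiableAt (by simp))]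
    refine ((congrArg (modelDeriv I (fun h : G ↦ h * g) 1 v + ·) ?_).trans (add_zero _)).symm
    exact map_zero (modelDeriv I (fun h : G ↦ 1 * h) g)

/-- The right-trivialization of a smooth vector field is smooth. -/
theorem SmoothVecAt.contMDiffAt_rightTranslateInv {X : VecField I G} {g : G}
    (hX : SmoothVecAt I X g) :
    ContMDiffAt I 𝓘(ℝ, E) ∞ (M' := E) (fun y ↦ rightTranslateInv I y (X y)) g := by
  -- Pairing `X g` with the zero vector at `g⁻¹` makes the tangent map of multiplication land in the
  -- fixed fibre over `1`.
  let fg : G → TangentBundle I G := fun g ↦ Bundle.TotalSpace.mk' E g⁻¹ 0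
  have sfg : ContMDiff I I.tangent ∞ fg :=
    (Bundle.contMDiff_zeroSection ℝ (TangentSpace I : G → Type _)).comp (contMDiff_inv I ∞)
  let F₁ : G → (TangentBundle I G × TangentBundle I G) := fun g ↦ (⟨g, X g⟩, fg g)
  have S₁ : ContMDiffAt I (I.tangent.prod I.tangent) ∞ F₁ g := hX.prodMk (sfg g)
  let F₂ : (TangentBundle I G × TangentBundle I G) → TangentBundle (I.prod I) (G × G) :=
    (equivTangentBundleProd I G I G).symm
  have S₂ : ContMDiff (I.tangent.prod I.tangent) (I.prod I).tangent ∞ F₂ :=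
    contMDiff_equivTangentBundleProd_symm
  let F₃ : TangentBundle (I.prod I) (G × G) → TangentBundle I G :=
    tangentMap (I.prod I) I (fun (p : G × G) ↦ p.1 * p.2)
  have S₃ : ContMDiff (I.prod I).tangent I.tangent ∞ F₃ :=
    ContMDiff.contMDiff_tangentMap (contMDiff_mul I ∞) (by simp)
  have S := ((S₃.comp S₂).contMDiffAt (x := F₁ g)).comp g S₁
  have hS : (F₃ ∘ F₂) ∘ F₁ =
      fun y ↦ (⟨1, rightTranslateInv I y (X y)⟩ : TangentBundle I G) := by
    funext y
    simp only [Function.comp_apply, tangentMap, F₃, F₂, F₁, fg]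
    rw [mfderiv_prod_eq_add_apply ((contMDiff_mul I ∞).mdifferentiableAt (by simp))]
    ext
    · simp
    · refine heq_of_eq ?_
      refine (congrArg (modelDeriv I (fun h : G ↦ h * y⁻¹) y (X y) + ·) ?_).trans (add_zero _)
      exact map_zero (modelDeriv I (fun h : G ↦ y * h) y⁻¹)
  rw [hS, Bundle.contMDiffAt_totalSpace] at S
  refine S.2.congr_of_eventuallyEq (.of_forall fun y ↦ ?_)
  -- Over its own centre `1` the bundle trivialization is the identity, so the fibre coordinate is
  -- the vector itself.
  exact (tangentCoordChange_self (I := I) (mem_extChartAt_source (I := I) (1 : G))).symm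

/-- Differentiate `h * h⁻¹ = 1` at the identity. -/
theorem modelDeriv_inv_one (v : E) : modelDeriv I (fun h : G ↦ h⁻¹) 1 v = -v := by
  have h : (fun p : G × G ↦ p.1 * p.2) ∘ (fun h : G ↦ (h, h⁻¹)) = fun _ ↦ 1 := by ext; simp
  have hm : MDifferentiableAt (I.prod I) I (fun p : G × G ↦ p.1 * p.2) ((1 : G), (1 : G)⁻¹) :=
    (contMDiff_mul I ∞).mdifferentiableAt (by simp)
  have key := mfderiv_comp (I := I) (I' := I.prod I) (I'' := I) (1 : G) hm
    (f := fun h : G ↦ (h, h⁻¹)) (mdifferentiableAt_id.prodMk (mdifferentiable_inv 1))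
  have key' := mfderiv_prod_eq_add_apply (v := (v, modelDeriv I (fun h : G ↦ h⁻¹) 1 v)) hm
  have e1 : (mfderiv I (I.prod I) (fun h : G ↦ (h, h⁻¹)) 1 : E →L[ℝ] E × E) v
      = (v, modelDeriv I (fun h : G ↦ h⁻¹) 1 v) := by
    refine (DFunLike.congr_fun
      (mfderiv_prodMk (f := fun h : G ↦ h) mdifferentiableAt_id (mdifferentiable_inv 1)) v).trans ?_
    exact congrArg₂ Prod.mk (modelDeriv_id (1 : G) v) rfl
  have e2 : (mfderiv (I.prod I) I (fun p : G × G ↦ p.1 * p.2) ((1 : G), (1 : G)⁻¹) :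
      E × E →L[ℝ] E) (v, modelDeriv I (fun h : G ↦ h⁻¹) 1 v)
      = 0 := by
    rw [← e1]
    refine (DFunLike.congr_fun key v).symm.trans ?_
    exact (congrArg (fun f ↦ modelDeriv I f 1 v) h).trans
      (DFunLike.congr_fun (mfderiv_const (I := I) (I' := I) (c := (1 : G))) v)
  have e3 : (0 : E) = modelDeriv I (fun h : G ↦ h * 1⁻¹) 1 v +
      modelDeriv I (fun h : G ↦ 1 * h) 1⁻¹ (modelDeriv I (fun h : G ↦ h⁻¹) 1 v) :=
    e2.symm.trans key'
  simp only [inv_one, mul_one, one_mul, modelDeriv_id] at e3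
  rw [eq_neg_iff_add_eq_zero, add_comm, ← e3]

/-- Since `(g⁻¹ * h)⁻¹ = h⁻¹ * g`, inversion turns left translation by `g⁻¹` into right translation
by `g` after inversion; the sign is the derivative of inversion at `1`. -/
theorem mpullback_inv_mulInvariantVectorField (v : GroupLieAlgebra I G) :
    mpullback I I (fun h : G ↦ h⁻¹) (mulInvariantVectorField v) = -rightInvField I v := by
  funext g
  have hinv : (modelDeriv I (fun h : G ↦ h⁻¹) g).inverse
      = modelDeriv I (fun h : G ↦ h⁻¹) g⁻¹ := by
    apply ContinuousLinearMap.inverse_eq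
    · ext w
      exact (modelDeriv_comp mdifferentiable_inv mdifferentiable_inv (inv_inv g)
        (fun z ↦ inv_inv z) w).trans (modelDeriv_id _ w)
    · ext w
      exact (modelDeriv_comp mdifferentiable_inv mdifferentiable_inv rfl
        (fun z ↦ inv_inv z) w).trans (modelDeriv_id _ w)
  change (modelDeriv I (fun h : G ↦ h⁻¹) g).inverse
      (modelDeriv I (fun h : G ↦ g⁻¹ * h) 1 (id v : E))
    = -(modelDeriv I (fun h : G ↦ h * g) 1 (id v : E))
  rw [hinv, modelDeriv_comp mdifferentiable_inv (mdifferentiable_mul_left g⁻¹) (mul_one _)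
    (h := fun h ↦ h⁻¹ * g) (fun z ↦ by simp), ← map_neg, ← modelDeriv_inv_one (I := I) (G := G),
    modelDeriv_comp (mdifferentiable_mul_right g) mdifferentiable_inv inv_one (fun z ↦ rfl)]

/-- Pull the bracket of left-invariant fields back by inversion: the two signs inside the bracket
cancel and the one outside remains. -/
theorem mlieBracket_rightInvField [CompleteSpace E] (v w : GroupLieAlgebra I G) (g : G) :
    mlieBracket I (rightInvField I v) (rightInvField I w) g = -rightInvField I ⁅v, w⁆ g := by
  have key := mpullback_mlieBracket (I := I) (I' := I) (x₀ := g) (n := ∞)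
    (f := fun h : G ↦ h⁻¹) (V := mulInvariantVectorField v) (W := mulInvariantVectorField w)
    (mdifferentiableAt_mulInvariantVectorField _) (mdifferentiableAt_mulInvariantVectorField _)
    (contMDiff_inv I ∞ g)
    (by rw [minSmoothness_of_isRCLikeNormedField]; exact WithTop.coe_le_coe.2 le_top)
  rw [← mulInvariantVector_mlieBracket, mpullback_inv_mulInvariantVectorField,
    mpullback_inv_mulInvariantVectorField, mpullback_inv_mulInvariantVectorField] at key
  have hs (u : GroupLieAlgebra I G) := (smoothVecAt_rightInvField u g).mdifferentiableAt (by simp)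
  have e (u : GroupLieAlgebra I G) : -rightInvField I u = (-1 : ℝ) • rightInvField I u :=
    (neg_one_smul ℝ _).symm
  rw [e v, e w, mlieBracket_const_smul_left (hs v), mlieBracket_const_smul_right (hs w),
    ← GroupLieAlgebra.bracket_def] at key
  simpa using key.symm

end RightInvariant

/-! ### Product and Leibniz rules -/

section Calculus

variable {E : Type*} [NormedAddCommGroup E] [NormedSpace ℝ E]
  {H : Type*} [TopologicalSpace H] {I : ModelWithCorners ℝ E H}
  {M : Type*} [TopologicalSpace M] [ChartedSpace H M]
  {F F' : Type*} [NormedAddCommGroup F] [NormedSpace ℝ F]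
  [NormedAddCommGroup F'] [NormedSpace ℝ F']

theorem mvfderiv_clm_apply {c : M → F →L[ℝ] F'} {f : M → F} {x : M}
    (hc : MDifferentiableAt I 𝓘(ℝ, F →L[ℝ] F') c x) (hf : MDifferentiableAt I 𝓘(ℝ, F) f x)
    (v : TangentSpace I x) :
    mvfderiv I (fun y ↦ c y (f y)) x v = c x (mvfderiv I f x v) + mvfderiv I c x v (f x) := by
  let c' : E →L[ℝ] F →L[ℝ] F' := mvfderiv I c x
  let f' : E →L[ℝ] F := mvfderiv I f x
  have h : HasMFDerivAt I 𝓘(ℝ, F') (fun y ↦ c y (f y)) x ((c x).comp f' + c'.flip (f x)) := by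
    refine ⟨(hc.clm_apply hf).continuousAt, ?_⟩
    have := HasFDerivWithinAt.clm_apply hc.hasMFDerivAt.2 hf.hasMFDerivAt.2
    simpa using! this
  exact DFunLike.congr_fun h.mfderiv v

theorem mvfderiv_clm_comp (L : F →L[ℝ] F') {f : M → F} {x : M}
    (hf : MDifferentiableAt I 𝓘(ℝ, F) f x) (v : TangentSpace I x) :
    mvfderiv I (fun y ↦ L (f y)) x v = L (mvfderiv I f x v) := by
  rw [mvfderiv_clm_apply mdifferentiableAt_const hf, mvfderiv_const]
  simp

variable [CompleteSpace E] [IsManifold I 2 M]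

theorem mlieBracket_sum_smul_right {ι : Type*} (s : Finset ι) (V : VecField I M)
    (f : ι → M → ℝ) (W : ι → VecField I M) (x : M)
    (hf : ∀ i, MDifferentiableAt I 𝓘(ℝ, ℝ) (f i) x)
    (hW : ∀ i, MDifferentiableAt I I.tangent (fun y ↦ (W i y : TangentBundle I M)) x) :
    mlieBracket I V (fun y ↦ ∑ i ∈ s, f i y • W i y) x =
      ∑ i ∈ s, (mvfderiv I (f i) x (V x) • W i x + f i x • mlieBracket I V (W i) x) := by
  classical
  induction s using Finset.induction_on with
  | empty =>
    simp only [Finset.sum_empty]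
    exact congrFun mlieBracket_zero_right x
  | insert i s hi ih =>
    simp only [Finset.sum_insert hi]
    rw [← ih, ← mlieBracket_smul_right (hf i) (hW i)]
    exact mlieBracket_add_right ((hf i).smul_section (hW i))
      (MDifferentiableAt.sum_section fun j _ ↦ (hf j).smul_section (hW j))

end Calculus

/-! ### The Lie bracket in the right-trivialization -/

section RightTrivialization

variable {E : Type*} [NormedAddCommGroup E] [NormedSpace ℝ E]
  {H : Type*} [TopologicalSpace H] {I : ModelWithCorners ℝ E H}
  {G : Type*} [TopologicalSpace G] [ChartedSpace H G] [Group G]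

variable (I G) in
/-- The bracket of the Lie algebra of `G`, on the model space. -/
def modelBracket (v w : E) : E :=
  Bracket.bracket (L := GroupLieAlgebra I G) (M := GroupLieAlgebra I G) v w

variable (I) in
/-- The vector field on `G` which corresponds to a function `ξ : G → 𝔤` in the
right-trivialization of the tangent bundle. -/
def ofRightTriv (ξ : G → E) : VecField I G :=
  fun g ↦ rightTranslate I g (ξ g)

variable (I) in
/-- The expression of a vector field on `G` in the right-trivialization of the tangent bundle. -/
def rightTriv (X : VecField I G) : G → E :=
  fun g ↦ rightTranslateInv I g (X g)

theorem ofRightTriv_eq_sum [FiniteDimensional ℝ E] (ξ : G → E) :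
    ofRightTriv I ξ = fun g ↦ ∑ i, (Module.finBasis ℝ E).coord i (ξ g) •
      rightInvField I (Module.finBasis ℝ E i : E) g := by
  funext g
  have : ξ g = ∑ i, (Module.finBasis ℝ E).coord i (ξ g) • Module.finBasis ℝ E i :=
    ((Module.finBasis ℝ E).sum_repr _).symm
  have h := congrArg (fun v : E ↦ (rightTranslate I g v : TangentSpace I g)) this
  refine h.trans ?_
  refine (map_sum (rightTranslate I g) (fun i ↦ (Module.finBasis ℝ E).coord i (ξ g) •
    Module.finBasis ℝ E i : _ → E) Finset.univ).trans ?_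
  exact Finset.sum_congr rfl fun i _ ↦ map_smul (rightTranslate I g) _ _

variable (I) in
/-- The 1-form on `G` which corresponds to a function `a : G → 𝔤*` in the
right-trivialization of the tangent bundle. -/
def ofRightTrivForm (a : G → E →L[ℝ] ℝ) : OneForm I G :=
  fun g ↦ (a g).toLinearMap ∘ₗ rightTranslateInv I g

variable [LieGroup I ∞ G]

theorem modelBracket_swap [CompleteSpace E] (v w : E) :
    modelBracket I G v w = -modelBracket I G w v :=
  (lie_skew (L := GroupLieAlgebra I G) v w).symm

@[simp]
theorem ofRightTriv_rightTriv (X : VecField I G) : ofRightTriv I (rightTriv I X) = X :=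
  funext fun g ↦ rightTranslate_rightTranslateInv g (X g)

theorem smoothFormAt_ofRightTrivForm {a : G → E →L[ℝ] ℝ} {g : G}
    (ha : ContMDiffAt I 𝓘(ℝ, E →L[ℝ] ℝ) ∞ a g) : SmoothFormAt I (ofRightTrivForm I a) g :=
  fun _ hX ↦ ha.clm_apply hX.contMDiffAt_rightTranslateInv

variable [FiniteDimensional ℝ E]

theorem smoothVecAt_iff_rightTriv {X : VecField I G} {g : G} :
    SmoothVecAt I X g ↔ ContMDiffAt I 𝓘(ℝ, E) ∞ (rightTriv I X) g := by
  refine ⟨SmoothVecAt.contMDiffAt_rightTranslateInv, fun h ↦ ?_⟩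
  rw [← ofRightTriv_rightTriv X, ofRightTriv_eq_sum]
  refine ContMDiffAt.sum_section fun i _ ↦ ContMDiffAt.smul_section ?_ ?_
  · have := ((Module.finBasis ℝ E).coord i).toContinuousLinearMap.contMDiff (n := ∞)
    exact this.contMDiffAt.comp g h
  · exact smoothVecAt_rightInvField _ g

variable [CompleteSpace E]

theorem mlieBracket_ofRightTriv_right (V : VecField I G) {η : G → E} {g : G}
    (hη : MDifferentiableAt I 𝓘(ℝ, E) η g) :
    mlieBracket I V (ofRightTriv I η) g =
      rightTranslate I g (mvfderiv I η g (V g)) + mlieBracket I V (rightInvField I (η g)) g := by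
  have key (ζ : G → E) (hζ : MDifferentiableAt I 𝓘(ℝ, E) ζ g) :
      mlieBracket I V (ofRightTriv I ζ) g = rightTranslate I g (mvfderiv I ζ g (V g)) +
        ∑ i, (Module.finBasis ℝ E).coord i (ζ g) •
          mlieBracket I V (rightInvField I (Module.finBasis ℝ E i : E)) g := by
    rw [ofRightTriv_eq_sum, mlieBracket_sum_smul_right, Finset.sum_add_distrib]
    · congr 1
      have h := congrFun (ofRightTriv_eq_sum (I := I) (fun _ : G ↦ mvfderiv I ζ g (V g))) g
      refine Eq.trans ?_ h.symm
      refine Finset.sum_congr rfl fun i _ ↦ ?_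
      congr 1
      exact mvfderiv_clm_comp ((Module.finBasis ℝ E).coord i).toContinuousLinearMap hζ (V g)
    · intro i
      exact ((Module.finBasis ℝ E).coord i).toContinuousLinearMap.mdifferentiableAt.comp g hζ
    · intro i
      exact (smoothVecAt_rightInvField _ g).mdifferentiableAt (by simp)
  have h0 : rightTranslate I g (mvfderiv I (fun _ : G ↦ η g) g (V g)) = 0 := by
    rw [mvfderiv_const]
    exact map_zero (rightTranslate I g)
  -- The sum in `key` sees only the value at `g`. Applying `key` to `η` frozen at that value kills
  -- the derivative term and identifies the sum with a bracket with a right-invariant field.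
  have hc := key (fun _ ↦ η g) mdifferentiableAt_const
  rw [h0, zero_add] at hc
  rw [key η hη, ← hc]
  rfl

/-- Freeze `η` at `g`, then by antisymmetry freeze `ξ`; what remains is a bracket of two
right-invariant fields. -/
theorem mlieBracket_ofRightTriv {ξ η : G → E} {g : G}
    (hξ : MDifferentiableAt I 𝓘(ℝ, E) ξ g) (hη : MDifferentiableAt I 𝓘(ℝ, E) η g) :
    mlieBracket I (ofRightTriv I ξ) (ofRightTriv I η) g =
      rightTranslate I g (mvfderiv I η g (ofRightTriv I ξ g)
        - mvfderiv I ξ g (ofRightTriv I η g) - modelBracket I G (ξ g) (η g)) := by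
  have hb := mlieBracket_rightInvField (I := I) (η g : E) (ξ g : E) g
  rw [mlieBracket_ofRightTriv_right _ hη, mlieBracket_swap_apply,
    mlieBracket_ofRightTriv_right _ hξ]
  let R : E →ₗ[ℝ] E := rightTranslate I g
  refine (congrArg (fun w : E ↦ R (mvfderiv I η g (ofRightTriv I ξ g)) +
    -(R (mvfderiv I ξ g (ofRightTriv I η g)) + w)) hb).trans ?_
  change R (mvfderiv I η g (ofRightTriv I ξ g)) + -(R (mvfderiv I ξ g (ofRightTriv I η g)) +
    -R (modelBracket I G (η g) (ξ g))) = R _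
  rw [modelBracket_swap]
  simp only [map_sub, map_neg]
  abel

end RightTrivialization

/-! ### Linear algebra of the sharp map -/

section Linear

variable {V W : Type*} [AddCommGroup V] [Module ℝ V] [AddCommGroup W] [Module ℝ W]
  [FiniteDimensional ℝ V] [FiniteDimensional ℝ W]

theorem eq_of_forall_dual_apply_eq {v w : V} (h : ∀ α : Module.Dual ℝ V, α v = α w) : v = w := by
  rw [← sub_eq_zero, ← Module.forall_dual_apply_eq_zero_iff ℝ]
  intro α
  rw [map_sub, h, sub_self]

theorem Tensor2.sharp_map (f : V →ₗ[ℝ] W) (r : Tensor2 V) (α : Module.Dual ℝ W) :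
    (r.map f).sharp α = f (r.sharp (f.dualMap α)) := by
  refine eq_of_forall_dual_apply_eq fun β ↦ ?_
  rw [Tensor2.apply_sharp]
  exact (Tensor2.apply_sharp r (f.dualMap β) (f.dualMap α)).symm

theorem Tensor2.apply_sharp_swap {r : Tensor2 V} (hr : r.IsAlt) (α β : Module.Dual ℝ V) :
    α (r.sharp β) = -β (r.sharp α) := by
  rw [Tensor2.apply_sharp, Tensor2.apply_sharp, hr.neg_eq β α]

end Linear

/-! ### Invariant tensors in the trivialization: torsion and concomitant -/

section RightTrivialization

variable {E : Type*} [NormedAddCommGroup E] [NormedSpace ℝ E]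
  {H : Type*} [TopologicalSpace H] {I : ModelWithCorners ℝ E H}
  {G : Type*} [TopologicalSpace G] [ChartedSpace H G] [Group G] [FiniteDimensional ℝ E]

variable (I) in
/-- The expression of a 1-form on `G` in the right-trivialization of the tangent bundle. -/
def rightTrivForm (α : OneForm I G) : G → E →L[ℝ] ℝ :=
  fun g ↦ LinearMap.toContinuousLinearMap (E := E) (α g ∘ₗ rightTranslate I g)

/-- `r^♯` as a map between spaces of continuous maps. -/
def sharpL (r : Tensor2 (GroupLieAlgebra I G)) : (E →L[ℝ] ℝ) →L[ℝ] E :=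
  LinearMap.toContinuousLinearMap (r.sharp ∘ₗ
    (LinearMap.toContinuousLinearMap (𝕜 := ℝ) (E := E) (F' := ℝ)).symm.toLinearMap)

/-- An endomorphism of the Lie algebra of `G` as a continuous endomorphism of the model space. -/
def endL (n : Module.End ℝ (GroupLieAlgebra I G)) : E →L[ℝ] E :=
  LinearMap.toContinuousLinearMap (E := E) (F' := E) n

theorem apply_sharpL_swap {r : Tensor2 (GroupLieAlgebra I G)} (hr : r.IsAlt) (a b : E →L[ℝ] ℝ) :
    a (sharpL r b) = -b (sharpL r a) :=
  Tensor2.apply_sharp_swap hr a.toLinearMap b.toLinearMap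

/-- Compatibility moves `n` across `r^♯` as its transpose, so `n ∘ r^♯` inherits skewness from `r`.
-/
theorem apply_endL_sharpL_swap {r : Tensor2 (GroupLieAlgebra I G)} (hr : r.IsAlt)
    {n : Module.End ℝ (GroupLieAlgebra I G)} (h : n ∘ₗ r.sharp = r.sharp ∘ₗ n.dualMap)
    (a b : E →L[ℝ] ℝ) : a (endL n (sharpL r b)) = -b (endL n (sharpL r a)) :=
  (congrArg a (DFunLike.congr_fun h b.toLinearMap)).trans
    (Tensor2.apply_sharp_swap hr a.toLinearMap (n.dualMap b.toLinearMap))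

variable [LieGroup I ∞ G]

theorem apply_eq_rightTrivForm (α : OneForm I G) (X : VecField I G) (g : G) :
    α g (X g) = rightTrivForm I α g (rightTriv I X g) :=
  congrArg (α g) (rightTranslate_rightTranslateInv g (X g)).symm

theorem rightTriv_sharpField (r : Tensor2 (GroupLieAlgebra I G)) (α : OneForm I G) :
    rightTriv I (sharpField I (rightInvTensor2 I r) α) =
      fun g ↦ sharpL r (rightTrivForm I α g) := by
  funext g
  exact (congrArg (rightTranslateInv I g) (Tensor2.sharp_map (rightTranslate I g) r (α g))).trans
    (rightTranslateInv_rightTranslate g _)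

theorem rightTriv_rightInvEnd (n : Module.End ℝ (GroupLieAlgebra I G)) (X : VecField I G) :
    rightTriv I (fun g ↦ rightInvEnd I n g (X g)) = fun g ↦ endL n (rightTriv I X g) :=
  funext fun g ↦ rightTranslateInv_rightTranslate g _

theorem rightTrivForm_transposeField (n : Module.End ℝ (GroupLieAlgebra I G)) (α : OneForm I G) :
    rightTrivForm I (transposeField I (rightInvEnd I n) α) =
      fun g ↦ (rightTrivForm I α g).comp (endL n) := by
  funext g
  ext v
  exact congrArg (fun w ↦ α g (rightTranslate I g (n w))) (rightTranslateInv_rightTranslate g v)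

@[simp]
theorem rightTrivForm_ofRightTrivForm (a : G → E →L[ℝ] ℝ) :
    rightTrivForm I (ofRightTrivForm I a) = a := by
  funext g
  ext v
  exact congrArg (a g) (rightTranslateInv_rightTranslate g v)

/-- The coefficients of the trivialized form are its values on a right-invariant frame, hence
smooth. -/
theorem SmoothFormAt.contMDiffAt_rightTrivForm {α : OneForm I G} {g : G}
    (hα : SmoothFormAt I α g) :
    ContMDiffAt I 𝓘(ℝ, E →L[ℝ] ℝ) ∞ (rightTrivForm I α) g := by
  have h : rightTrivForm I α = fun y ↦ ∑ i,
      α y (rightInvField I (Module.finBasis ℝ E i : E) y) •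
        LinearMap.toContinuousLinearMap ((Module.finBasis ℝ E).coord i) := by
    funext y
    refine ContinuousLinearMap.coe_injective ((Module.finBasis ℝ E).ext fun j ↦ ?_)
    simp [Finsupp.single_apply]
    rfl
  rw [h]
  refine ContMDiffAt.sum fun i _ ↦ ?_
  have h1 := hα _ (smoothVecAt_rightInvField (Module.finBasis ℝ E i : E) g)
  have h2 : ContMDiff 𝓘(ℝ, ℝ) 𝓘(ℝ, E →L[ℝ] ℝ) ∞ (fun t : ℝ ↦
      t • LinearMap.toContinuousLinearMap ((Module.finBasis ℝ E).coord i)) :=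
    ((contDiff_id (n := ∞)).smul contDiff_const).contMDiff
  exact h2.contMDiffAt.comp g h1

theorem smoothEnd_rightInvEnd (n : Module.End ℝ (GroupLieAlgebra I G)) :
    SmoothEnd I (rightInvEnd I n) := by
  intro g X hX
  rw [smoothVecAt_iff_rightTriv] at hX ⊢
  rw [rightTriv_rightInvEnd]
  exact (endL n).contMDiff.contMDiffAt.comp g hX

theorem smoothTensor2_rightInvTensor2 (r : Tensor2 (GroupLieAlgebra I G)) :
    SmoothTensor2 I (rightInvTensor2 I r) := by
  intro g α β hα hβ
  have h : (fun y ↦ rightInvTensor2 I r y (α y) (β y)) =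
      fun y ↦ rightTrivForm I α y (sharpL r (rightTrivForm I β y)) := by
    funext y
    exact (Tensor2.apply_sharp r ((rightTranslate I y).dualMap (α y))
      ((rightTranslate I y).dualMap (β y))).symm
  rw [h]
  exact hα.contMDiffAt_rightTrivForm.clm_apply
    ((sharpL r).contMDiff.contMDiffAt.comp g hβ.contMDiffAt_rightTrivForm)

theorem SmoothVecAt.mdifferentiableAt_rightTriv {X : VecField I G} {g : G}
    (hX : SmoothVecAt I X g) : MDifferentiableAt I 𝓘(ℝ, E) (rightTriv I X) g :=
  (smoothVecAt_iff_rightTriv.1 hX).mdifferentiableAt (by simp)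

theorem SmoothFormAt.mdifferentiableAt_rightTrivForm {α : OneForm I G} {g : G}
    (hα : SmoothFormAt I α g) : MDifferentiableAt I 𝓘(ℝ, E →L[ℝ] ℝ) (rightTrivForm I α) g :=
  hα.contMDiffAt_rightTrivForm.mdifferentiableAt (by simp)

variable [CompleteSpace E]

theorem mlieBracket_eq_rightTriv {X Y : VecField I G} {g : G}
    (hX : MDifferentiableAt I 𝓘(ℝ, E) (rightTriv I X) g)
    (hY : MDifferentiableAt I 𝓘(ℝ, E) (rightTriv I Y) g) :
    mlieBracket I X Y g = rightTranslate I g (mvfderiv I (rightTriv I Y) g (X g)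
        - mvfderiv I (rightTriv I X) g (Y g)
        - modelBracket I G (rightTriv I X g) (rightTriv I Y g) : E) := by
  simpa only [ofRightTriv_rightTriv] using! mlieBracket_ofRightTriv hX hY

theorem torsion_rightInvEnd (n : Module.End ℝ (GroupLieAlgebra I G)) {X Y : VecField I G} {g : G}
    (hX : SmoothVecAt I X g) (hY : SmoothVecAt I Y g) :
    torsion I (rightInvEnd I n) X Y g =
      -rightTranslate I g (algTorsion n (rightTriv I X g : E) (rightTriv I Y g : E)) := by
  have dX := hX.mdifferentiableAt_rightTriv
  have dY := hY.mdifferentiableAt_rightTriv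
  have dNX := (smoothEnd_rightInvEnd n g X hX).mdifferentiableAt_rightTriv
  have dNY := (smoothEnd_rightInvEnd n g Y hY).mdifferentiableAt_rightTriv
  let R : E →ₗ[ℝ] E := rightTranslate I g
  let S : E →ₗ[ℝ] E := rightTranslateInv I g
  have hSR (v : E) : S (R v) = v := rightTranslateInv_rightTranslate g v
  let ξ : E := rightTriv I X g
  let η : E := rightTriv I Y g
  let ν : E →L[ℝ] E := endL n
  let dξ : E →L[ℝ] E := mvfderiv I (rightTriv I X) g
  let dη : E →L[ℝ] E := mvfderiv I (rightTriv I Y) g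
  let X' : E := X g
  let Y' : E := Y g
  let NX' : E := rightInvEnd I n g (X g)
  let NY' : E := rightInvEnd I n g (Y g)
  have e1 : mlieBracket I (fun y ↦ rightInvEnd I n y (X y)) (fun y ↦ rightInvEnd I n y (Y y)) g =
      R (ν (dη NX') - ν (dξ NY') - modelBracket I G (ν ξ) (ν η)) := by
    rw [mlieBracket_eq_rightTriv dNX dNY, rightTriv_rightInvEnd, rightTriv_rightInvEnd,
      mvfderiv_clm_comp _ dX, mvfderiv_clm_comp _ dY]
    rfl
  have e2 : mlieBracket I (fun y ↦ rightInvEnd I n y (X y)) Y g =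
      R (dη NX' - ν (dξ Y') - modelBracket I G (ν ξ) η) := by
    rw [mlieBracket_eq_rightTriv dNX dY, rightTriv_rightInvEnd, mvfderiv_clm_comp _ dX]
    rfl
  have e3 : mlieBracket I X (fun y ↦ rightInvEnd I n y (Y y)) g =
      R (ν (dη X') - dξ NY' - modelBracket I G ξ (ν η)) := by
    rw [mlieBracket_eq_rightTriv dX dNY, rightTriv_rightInvEnd, mvfderiv_clm_comp _ dY]
    rfl
  have e4 : mlieBracket I X Y g = R (dη X' - dξ Y' - modelBracket I G ξ η) :=
    mlieBracket_eq_rightTriv dX dY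
  rw [torsion, e1, e2, e3, e4]
  -- At `g` the invariant endomorphism is `R ∘ ν ∘ S`. Once `S ∘ R` is removed, each derivative of
  -- `ξ` or `η` occurs twice with opposite signs.
  change R _ - R (ν (S (R _))) - R (ν (S (R _))) + R (ν (S (R (ν (S (R _)))))) =
    -R (modelBracket I G (ν ξ) (ν η) - ν (modelBracket I G (ν ξ) η)
      - ν (modelBracket I G ξ (ν η)) + ν (ν (modelBracket I G ξ η)))
  simp only [hSR, map_sub, map_add]
  abel

/-- The derivative of `Y` along `X` appears both in `X (α Y)` and in `α [X, Y]`, and drops out. -/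
theorem lieDerivForm_eq_rightTriv {X Y : VecField I G} {α : OneForm I G} {g : G}
    (hX : MDifferentiableAt I 𝓘(ℝ, E) (rightTriv I X) g)
    (hY : MDifferentiableAt I 𝓘(ℝ, E) (rightTriv I Y) g)
    (hα : MDifferentiableAt I 𝓘(ℝ, E →L[ℝ] ℝ) (rightTrivForm I α) g) :
    lieDerivForm I X α Y g =
      mvfderiv I (rightTrivForm I α) g (X g) (rightTriv I Y g)
        + rightTrivForm I α g (mvfderiv I (rightTriv I X) g (Y g))
        + rightTrivForm I α g (modelBracket I G (rightTriv I X g) (rightTriv I Y g)) := by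
  rw [lieDerivForm, dirDeriv, mlieBracket_eq_rightTriv hX hY]
  simp_rw [apply_eq_rightTrivForm α]
  rw [mvfderiv_clm_apply hα hY]
  let a : E →L[ℝ] ℝ := rightTrivForm I α g
  change _ - a _ = _
  rw [map_sub, map_sub]
  ring

theorem concomitant_rightInv {r : Tensor2 (GroupLieAlgebra I G)} (hr : r.IsAlt)
    {n : Module.End ℝ (GroupLieAlgebra I G)} (hn : n ∘ₗ r.sharp = r.sharp ∘ₗ n.dualMap)
    {α β : OneForm I G} {Y : VecField I G} {g : G}
    (hα : SmoothFormAt I α g) (hβ : SmoothFormAt I β g) (hY : SmoothVecAt I Y g) :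
    concomitant I (rightInvTensor2 I r) (rightInvEnd I n) α β Y g =
      -algConcomitant r n (rightTrivForm I α g).toLinearMap (rightTrivForm I β g).toLinearMap
        (rightTriv I Y g : E) := by
  have dα := hα.mdifferentiableAt_rightTrivForm
  have dβ := hβ.mdifferentiableAt_rightTrivForm
  have dY := hY.mdifferentiableAt_rightTriv
  have dNY := (smoothEnd_rightInvEnd n g Y hY).mdifferentiableAt_rightTriv
  have dsharp {γ : OneForm I G} (dγ : MDifferentiableAt I 𝓘(ℝ, E →L[ℝ] ℝ) (rightTrivForm I γ) g) :
      MDifferentiableAt I 𝓘(ℝ, E) (fun y ↦ sharpL r (rightTrivForm I γ y)) g :=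
    (sharpL r).mdifferentiableAt.comp g dγ
  let ν : E →L[ℝ] E := endL n
  let νt : (E →L[ℝ] ℝ) →L[ℝ] (E →L[ℝ] ℝ) := ContinuousLinearMap.precomp ℝ ν
  let ρ : (E →L[ℝ] ℝ) →L[ℝ] E := sharpL r
  let a : E →L[ℝ] ℝ := rightTrivForm I α g
  let b : E →L[ℝ] ℝ := rightTrivForm I β g
  let da : E →L[ℝ] E →L[ℝ] ℝ := mvfderiv I (rightTrivForm I α) g
  let db : E →L[ℝ] E →L[ℝ] ℝ := mvfderiv I (rightTrivForm I β) g
  let η : E := rightTriv I Y g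
  let Y' : E := Y g
  let NY' : E := rightInvEnd I n g (Y g)
  let Xα : E := sharpField I (rightInvTensor2 I r) α g
  let Xβ : E := sharpField I (rightInvTensor2 I r) β g
  have hL {γ δ : OneForm I G} (dγ : MDifferentiableAt I 𝓘(ℝ, E →L[ℝ] ℝ) (rightTrivForm I γ) g)
      (dδ : MDifferentiableAt I 𝓘(ℝ, E →L[ℝ] ℝ) (rightTrivForm I δ) g) :
      lieDerivForm I (sharpField I (rightInvTensor2 I r) γ)
          (transposeField I (rightInvEnd I n) δ) Y g =
        mvfderiv I (rightTrivForm I δ) g (sharpField I (rightInvTensor2 I r) γ g) (ν η)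
          + rightTrivForm I δ g (ν (ρ (mvfderiv I (rightTrivForm I γ) g (Y g))))
          + rightTrivForm I δ g (ν (modelBracket I G (ρ (rightTrivForm I γ g)) η)) := by
    have dt : MDifferentiableAt I 𝓘(ℝ, E →L[ℝ] ℝ) (fun y ↦ νt (rightTrivForm I δ y)) g :=
      νt.mdifferentiableAt.comp g dδ
    have ht : rightTrivForm I (transposeField I (rightInvEnd I n) δ) =
      fun y ↦ νt (rightTrivForm I δ y) := rightTrivForm_transposeField n δ
    rw [lieDerivForm_eq_rightTriv (by rw [rightTriv_sharpField]; exact dsharp dγ) dY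
      (by rw [ht]; exact dt), rightTriv_sharpField, ht, mvfderiv_clm_comp νt dδ,
      mvfderiv_clm_comp _ dγ]
    rfl
  have hL' {γ δ : OneForm I G} (dγ : MDifferentiableAt I 𝓘(ℝ, E →L[ℝ] ℝ) (rightTrivForm I γ) g)
      (dδ : MDifferentiableAt I 𝓘(ℝ, E →L[ℝ] ℝ) (rightTrivForm I δ) g) :
      lieDerivForm I (sharpField I (rightInvTensor2 I r) γ) δ
          (fun y ↦ rightInvEnd I n y (Y y)) g =
        mvfderiv I (rightTrivForm I δ) g (sharpField I (rightInvTensor2 I r) γ g) (ν η)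
          + rightTrivForm I δ g (ρ (mvfderiv I (rightTrivForm I γ) g (rightInvEnd I n g (Y g))))
          + rightTrivForm I δ g (modelBracket I G (ρ (rightTrivForm I γ g)) (ν η)) := by
    rw [lieDerivForm_eq_rightTriv (by rw [rightTriv_sharpField]; exact dsharp dγ) dNY dδ,
      rightTriv_sharpField, rightTriv_rightInvEnd, mvfderiv_clm_comp _ dγ]
  have h5 : dirDeriv I Y (fun y ↦ α y (rightInvEnd I n y
      (sharpField I (rightInvTensor2 I r) β y))) g = a (ν (ρ (db Y'))) + da Y' (ν (ρ b)) := by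
    have e : (fun y ↦ α y (rightInvEnd I n y (sharpField I (rightInvTensor2 I r) β y))) =
        fun y ↦ rightTrivForm I α y ((ν.comp ρ) (rightTrivForm I β y)) := by
      funext y
      rw [apply_eq_rightTrivForm α fun y ↦ rightInvEnd I n y _, rightTriv_rightInvEnd,
        rightTriv_sharpField]
      rfl
    rw [dirDeriv, e, mvfderiv_clm_apply (f := fun y ↦ (ν.comp ρ) (rightTrivForm I β y)) dα
      ((ν.comp ρ).mdifferentiableAt.comp g dβ),
      mvfderiv_clm_comp _ dβ]
    rfl
  have h6 : dirDeriv I (fun y ↦ rightInvEnd I n y (Y y)) (fun y ↦ α y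
      (sharpField I (rightInvTensor2 I r) β y)) g = a (ρ (db NY')) + da NY' (ρ b) := by
    have e : (fun y ↦ α y (sharpField I (rightInvTensor2 I r) β y)) =
        fun y ↦ rightTrivForm I α y (ρ (rightTrivForm I β y)) := by
      funext y
      rw [apply_eq_rightTrivForm α, rightTriv_sharpField]
    rw [dirDeriv, e, mvfderiv_clm_apply dα (dsharp dβ), mvfderiv_clm_comp _ dβ]
    rfl
  simp only [concomitant]
  rw [hL dα dβ, hL dβ dα, hL' dα dβ, hL' dβ dα, h5, h6]
  change db Xα (ν η) + b (ν (ρ (da Y'))) + b (ν (modelBracket I G (ρ a) η))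
    - (da Xβ (ν η) + a (ν (ρ (db Y'))) + a (ν (modelBracket I G (ρ b) η)))
    + (da Xβ (ν η) + a (ρ (db NY')) + a (modelBracket I G (ρ b) (ν η)))
    - (db Xα (ν η) + b (ρ (da NY')) + b (modelBracket I G (ρ a) (ν η)))
    + (a (ν (ρ (db Y'))) + da Y' (ν (ρ b))) - (a (ρ (db NY')) + da NY' (ρ b))
    = -(-b (ν (modelBracket I G (ρ a) η)) - -a (ν (modelBracket I G (ρ b) η))
      - -b (modelBracket I G (ρ a) (ν η)) + -a (modelBracket I G (ρ b) (ν η)))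
  -- The derivatives of `b` and those of `a` along `Xβ` already cancel in pairs; skewness of `n ∘
  -- r^♯` and of `r^♯` disposes of the derivatives of `a` along `Y` and `NY`.
  have s1 : b (ν (ρ (da Y'))) = -da Y' (ν (ρ b)) := apply_endL_sharpL_swap hr hn _ _
  have s2 : b (ρ (da NY')) = -da NY' (ρ b) := apply_sharpL_swap hr _ _
  rw [s1, s2]
  ring

end RightTrivialization

/-! ### Schouten bracket in a moving frame -/

section VectorSpace

variable {E : Type*} [NormedAddCommGroup E] [NormedSpace ℝ E] [FiniteDimensional ℝ E]

theorem differentiableWithinAt_of_forall_apply {F : Type*} [NormedAddCommGroup F]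
    [NormedSpace ℝ F] {A : E → E →L[ℝ] F} {s : Set E} {y : E}
    (hA : ∀ v, DifferentiableWithinAt ℝ (fun z ↦ A z v) s y) :
    DifferentiableWithinAt ℝ A s y := by
  let e := LinearMap.toContinuousLinearMap (𝕜 := ℝ) (E := E) (F' := ℝ)
  have h : A = fun z ↦ ∑ i,
      (e ((Module.finBasis ℝ E).coord i)).smulRight (A z (Module.finBasis ℝ E i)) := by
    funext z
    refine ContinuousLinearMap.coe_injective ((Module.finBasis ℝ E).ext fun j ↦ ?_)
    simp [e, Finsupp.single_apply]
  rw [h]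
  refine DifferentiableWithinAt.fun_sum fun i _ ↦ ?_
  exact (ContinuousLinearMap.smulRightL ℝ E F
    (e ((Module.finBasis ℝ E).coord i))).differentiable.differentiableAt.comp_differentiableWithinAt
      y (hA (Module.finBasis ℝ E i))

/-- The Schouten bracket with itself of a bivector field which has constant coefficients in a
moving frame, in terms of the Lie brackets of the fields of the frame. -/
theorem schoutenWithin_map_self {r : Tensor2 E} (hr : r.IsAlt) {A : E → E →L[ℝ] E} {s : Set E}
    {y : E} (hA : DifferentiableWithinAt ℝ A s y) (hs : UniqueDiffWithinAt ℝ s y)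
    (α β γ : Module.Dual ℝ E) :
    let L (v w : E) : E := lieBracketWithin ℝ (fun z ↦ A z v) (fun z ↦ A z w) s y
    let ρ (α : Module.Dual ℝ E) : E := r.sharp ((A y).toLinearMap.dualMap α)
    schoutenWithin (fun z ↦ r.map (A z).toLinearMap) (fun z ↦ r.map (A z).toLinearMap) s y α β γ =
      2 * (γ (L (ρ α) (ρ β)) + α (L (ρ β) (ρ γ)) + β (L (ρ γ) (ρ α))) := by
  intro L ρ
  let e := LinearMap.toContinuousLinearMap (𝕜 := ℝ) (E := E) (F' := ℝ)
  let R : (E →L[ℝ] ℝ) →L[ℝ] E := LinearMap.toContinuousLinearMap (r.sharp ∘ₗ e.symm.toLinearMap)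
  let dA : E →L[ℝ] E →L[ℝ] E := fderivWithin ℝ A s y
  have hRswap (a b : E →L[ℝ] ℝ) : a (R b) = -b (R a) :=
    Tensor2.apply_sharp_swap hr a.toLinearMap b.toLinearMap
  have hcomp (β : Module.Dual ℝ E) : HasFDerivWithinAt (fun z ↦ (e β).comp (A z))
      ((ContinuousLinearMap.compL ℝ E E ℝ (e β)).comp dA) s y :=
    (ContinuousLinearMap.compL ℝ E E ℝ (e β)).hasFDerivAt.comp_hasFDerivWithinAt y
      hA.hasFDerivWithinAt
  have hD (β γ : Module.Dual ℝ E) (u : E) :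
      fderivWithin ℝ (fun z ↦ r.map (A z).toLinearMap β γ) s y u =
        β (dA u (ρ γ)) - γ (dA u (ρ β)) := by
    have hfun : (fun z ↦ r.map (A z).toLinearMap β γ) =
        fun z ↦ (e β).comp (A z) (R ((e γ).comp (A z))) := by
      funext z
      exact (Tensor2.apply_sharp r ((A z).toLinearMap.dualMap β)
        ((A z).toLinearMap.dualMap γ)).symm
    have hRγ : HasFDerivWithinAt (fun z ↦ R ((e γ).comp (A z))) _ s y :=
      R.hasFDerivAt.comp_hasFDerivWithinAt y (hcomp γ)
    rw [hfun, ((hcomp β).clm_apply hRγ).fderivWithin hs]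
    -- The product rule differentiates the frame in both slots of `r`; skewness moves the second
    -- derivative outside `r^♯`.
    have h1 := hRswap ((e β).comp (A y)) ((e γ).comp (dA u))
    change ((e β).comp (A y)) (R ((e γ).comp (dA u))) + β (dA u (ρ γ)) = _
    rw [h1]
    change -γ (dA u (ρ β)) + _ = _
    ring
  have hL (v w : E) : L v w = dA (A y v) w - dA (A y w) v := by
    have hv (v : E) (u : E) : fderivWithin ℝ (fun z ↦ A z v) s y u = dA u v := by
      rw [fderivWithin_clm_apply hs hA (differentiableWithinAt_const v)]
      simp [dA]
    simp only [L, lieBracketWithin, hv]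
  have hsharp (α : Module.Dual ℝ E) : (r.map (A y).toLinearMap).sharp α = A y (ρ α) :=
    Tensor2.sharp_map _ r α
  simp only [schoutenWithin, hD, hsharp, hL, map_sub]
  ring

end VectorSpace

/-! ### Schouten bracket of a right-invariant bivector field -/

section Group

variable {E : Type*} [NormedAddCommGroup E] [NormedSpace ℝ E]
  {H : Type*} [TopologicalSpace H] {I : ModelWithCorners ℝ E H}
  {G : Type*} [TopologicalSpace G] [ChartedSpace H G] [Group G] [FiniteDimensional ℝ E]
  [CompleteSpace E] [LieGroup I ∞ G]

theorem schouten_rightInvTensor2 {r : Tensor2 (GroupLieAlgebra I G)} (hr : r.IsAlt) (g : G)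
    (α β γ : Module.Dual ℝ (TangentSpace I g)) :
    schouten I (rightInvTensor2 I r) (rightInvTensor2 I r) g α β γ =
      -algSchouten r r ((rightTranslate I g).dualMap α) ((rightTranslate I g).dualMap β)
        ((rightTranslate I g).dualMap γ) := by
  -- The right-invariant frame in the chart at `g`: `A z v` is the chart expression of the
  -- right-invariant field of `v`.
  let A (z : E) : E →L[ℝ] E := LinearMap.toContinuousLinearMap (E := E) (F' := E)
    ((mfderivWithin 𝓘(ℝ, E) I (extChartAt I g).symm (range I) z).inverse.toLinearMap ∘ₗ
      rightTranslate I ((extChartAt I g).symm z))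
  let J : E →L[ℝ] E := (mfderiv I 𝓘(ℝ, E) (extChartAt I g) g).inverse
  let R : E →ₗ[ℝ] E := rightTranslate I g
  have hset : (extChartAt I g).symm ⁻¹' univ ∩ range I = range I := by simp
  have hA : DifferentiableWithinAt ℝ A (range I) (extChartAt I g g) := by
    refine differentiableWithinAt_of_forall_apply fun v ↦ ?_
    have h := ((smoothVecAt_rightInvField (I := I) v g).mdifferentiableAt
      (by simp)).mdifferentiableWithinAt (s := univ)
    have h' := h.differentiableWithinAt_mpullbackWithin_vectorField
    rw [hset] at h'
    exact h'
  have hs : UniqueDiffWithinAt ℝ (range I) (extChartAt I g g) :=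
    I.uniqueDiffOn _ (extChartAt_target_subset_range g (mem_extChartAt_target g))
  have hL (v w : E) : J (lieBracketWithin ℝ (fun z ↦ A z v) (fun z ↦ A z w) (range I)
      (extChartAt I g g)) = -R (modelBracket I G v w) := by
    have h := mlieBracket_rightInvField (I := I) (v : E) (w : E) g
    rw [← mlieBracketWithin_univ, mlieBracketWithin_apply, hset] at h
    exact h
  -- At the centre of the chart `J` undoes the passage to coordinates, so all covectors become
  -- pullbacks by right translation.
  have hJ (v : E) : J (A (extChartAt I g g) v) = R v := by
    have h := mfderiv_extChartAt_inverse_comp_mfderivWithin_extChartAT_symm (I := I) (x := g) (R v)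
    refine Eq.trans ?_ h
    have e : (rightInvField I v ((extChartAt I g).symm (extChartAt I g g)) : E) = R v :=
      congrArg (fun z ↦ (rightInvField I v z : E)) (extChartAt_to_inv g)
    exact congrArg (fun w : E ↦ J ((mfderivWithin 𝓘(ℝ, E) I (extChartAt I g).symm (range I)
      (extChartAt I g g)).inverse w)) e
  let L (v w : E) : E := lieBracketWithin ℝ (fun z ↦ A z v) (fun z ↦ A z w) (range I)
    (extChartAt I g g)
  let B : Module.Dual ℝ E →ₗ[ℝ] Module.Dual ℝ E := (A (extChartAt I g g)).toLinearMap.dualMap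
  let Jt : Module.Dual ℝ E →ₗ[ℝ] Module.Dual ℝ E := J.toLinearMap.dualMap
  let Rt : Module.Dual ℝ E →ₗ[ℝ] Module.Dual ℝ E := R.dualMap
  have hdual (α : Module.Dual ℝ E) : B (Jt α) = Rt α :=
    LinearMap.ext fun v ↦ congrArg α (hJ v)
  have hneg (α : Module.Dual ℝ E) (v w : E) :
      α (J (L v w)) = -Rt α (modelBracket I G v w) :=
    (congrArg α (hL v w)).trans (map_neg α _)
  let r' : Tensor2 E := r
  let ρ (α : Module.Dual ℝ E) : E := r'.sharp α
  have main (α β γ : Module.Dual ℝ E) :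
      schoutenWithin (fun z ↦ r'.map (A z).toLinearMap) (fun z ↦ r'.map (A z).toLinearMap)
        (range I) (extChartAt I g g) (Jt α) (Jt β) (Jt γ) =
      -((Rt γ (modelBracket I G (ρ (Rt α)) (ρ (Rt β)))
          + Rt γ (modelBracket I G (ρ (Rt α)) (ρ (Rt β))))
        + (Rt α (modelBracket I G (ρ (Rt β)) (ρ (Rt γ)))
          + Rt α (modelBracket I G (ρ (Rt β)) (ρ (Rt γ))))
        + (Rt β (modelBracket I G (ρ (Rt γ)) (ρ (Rt α)))
          + Rt β (modelBracket I G (ρ (Rt γ)) (ρ (Rt α))))) := by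
    have key : _ = 2 * (γ (J (L (ρ (B (Jt α))) (ρ (B (Jt β)))))
        + α (J (L (ρ (B (Jt β))) (ρ (B (Jt γ))))) + β (J (L (ρ (B (Jt γ))) (ρ (B (Jt α)))))) :=
      schoutenWithin_map_self (r := r') hr hA hs (Jt α) (Jt β) (Jt γ)
    rw [key, hdual, hdual, hdual, hneg, hneg, hneg]
    ring
  exact main α β γ

end Group

/-! ### Transport along Lie algebra isomorphisms -/

section Transport

variable {𝔤 𝔥 : Type*} [LieRing 𝔤] [LieAlgebra ℝ 𝔤] [FiniteDimensional ℝ 𝔤]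
  [LieRing 𝔥] [LieAlgebra ℝ 𝔥] [FiniteDimensional ℝ 𝔥]

/-- r-n structures are transported by isomorphisms of Lie algebras. -/
theorem IsRNStructure.map {r : Tensor2 𝔤} {n : Module.End ℝ 𝔤} (h : IsRNStructure r n)
    (φ : 𝔤 ≃ₗ⁅ℝ⁆ 𝔥) :
    IsRNStructure (r.map ((φ : 𝔤 →ₗ⁅ℝ⁆ 𝔥) : 𝔤 →ₗ[ℝ] 𝔥)) (φ.toLinearEquiv.conj n) := by
  let f : 𝔤 →ₗ[ℝ] 𝔥 := ((φ : 𝔤 →ₗ⁅ℝ⁆ 𝔥) : 𝔤 →ₗ[ℝ] 𝔥)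
  have hf (X Y : 𝔤) : ⁅f X, f Y⁆ = f ⁅X, Y⁆ := (LieEquiv.map_lie φ X Y).symm
  have hn (X : 𝔤) : φ.toLinearEquiv.conj n (f X) = f (n X) :=
    congrArg (fun Z ↦ f (n Z)) (φ.symm_apply_apply X)
  have hsurj (X : 𝔥) : ∃ Z, X = f Z := ⟨φ.symm X, (φ.apply_symm_apply X).symm⟩
  have hs (α : Module.Dual ℝ 𝔥) : (r.map f).sharp α = f (r.sharp (f.dualMap α)) :=
    Tensor2.sharp_map f r α
  have hnt (α : Module.Dual ℝ 𝔥) :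
      f.dualMap ((φ.toLinearEquiv.conj n).dualMap α) = n.dualMap (f.dualMap α) :=
    LinearMap.ext fun X ↦ congrArg α (hn X)
  change IsRNStructure (r.map f) _
  refine ⟨fun α ↦ h.alt _, fun α β γ ↦ ?_, fun X Y ↦ ?_, ?_, fun α β ↦ ?_⟩
  · simp only [algSchouten, hs, hf]
    exact h.cybe (f.dualMap α) (f.dualMap β) (f.dualMap γ)
  · obtain ⟨X, rfl⟩ := hsurj X
    obtain ⟨Y, rfl⟩ := hsurj Y
    simp only [algTorsion, hn, hf, ← map_sub, ← map_add]
    exact (congrArg f (h.torsion X Y)).trans (map_zero f)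
  · ext1 α
    simp only [LinearMap.comp_apply, hs, hn, hnt]
    exact congrArg f (DFunLike.congr_fun h.comp_sharp (f.dualMap α))
  · ext X
    obtain ⟨X, rfl⟩ := hsurj X
    have := DFunLike.congr_fun (h.concomitant (f.dualMap α) (f.dualMap β)) X
    simpa [algConcomitant, coad, hs, hn, hf] using this

end Transport

/-! ### Both directions of the correspondence -/

section Group

variable {E : Type*} [NormedAddCommGroup E] [NormedSpace ℝ E]
  {H : Type*} [TopologicalSpace H] {I : ModelWithCorners ℝ E H}
  {G : Type*} [TopologicalSpace G] [ChartedSpace H G] [Group G]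

theorem rightInvTensor2_one (r : Tensor2 (GroupLieAlgebra I G)) : rightInvTensor2 I r 1 = r := by
  have h : rightTranslate I (1 : G) = LinearMap.id := LinearMap.ext rightTranslate_one
  ext α β
  simp [rightInvTensor2, h, Tensor2.map]

variable [LieGroup I ∞ G]

theorem rightInvEnd_one (n : Module.End ℝ (GroupLieAlgebra I G)) : rightInvEnd I n 1 = n := by
  ext v
  exact (rightTranslate_one _).trans (congrArg n (rightTranslateInv_one v))

variable [FiniteDimensional ℝ E] [CompleteSpace E]

theorem IsRNStructure.isPoissonNijenhuis {r : Tensor2 (GroupLieAlgebra I G)}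
    {n : Module.End ℝ (GroupLieAlgebra I G)} (h : IsRNStructure r n) :
    IsPoissonNijenhuis I (rightInvTensor2 I r) (rightInvEnd I n) where
  alt g α := h.alt _
  smooth_bivector := smoothTensor2_rightInvTensor2 r
  smooth_end := smoothEnd_rightInvEnd n
  poisson g α β γ := by
    rw [schouten_rightInvTensor2 h.alt, h.cybe, neg_zero]
  nijenhuis X Y hX hY g := by
    rw [torsion_rightInvEnd n (hX g) (hY g), neg_eq_zero]
    exact (congrArg (rightTranslate I g) (h.torsion _ _)).trans (map_zero _)
  comp_sharp g := by
    have hs (α : Module.Dual ℝ (TangentSpace I g)) : (rightInvTensor2 I r g).sharp α =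
        rightTranslate I g (r.sharp ((rightTranslate I g).dualMap α)) := Tensor2.sharp_map _ r α
    ext1 α
    simp only [LinearMap.comp_apply, hs, rightInvEnd, rightTranslateInv_rightTranslate]
    refine congrArg (rightTranslate I g) ((DFunLike.congr_fun h.comp_sharp _).trans ?_)
    refine congrArg r.sharp (LinearMap.ext fun v ↦ ?_)
    simp only [LinearMap.dualMap_apply, LinearMap.comp_apply, rightTranslateInv_rightTranslate]
  concomitant α β hα hβ Y hY g := by
    rw [concomitant_rightInv h.alt h.comp_sharp (hα g) (hβ g) (hY g), neg_eq_zero]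
    exact DFunLike.congr_fun (h.concomitant _ _) _

theorem isRNStructure_of_isPoissonNijenhuis {r : Tensor2 (GroupLieAlgebra I G)}
    {n : Module.End ℝ (GroupLieAlgebra I G)}
    (h : IsPoissonNijenhuis I (rightInvTensor2 I r) (rightInvEnd I n)) : IsRNStructure r n := by
  have halt : r.IsAlt := by simpa only [rightInvTensor2_one] using h.alt 1
  have hcomp : n ∘ₗ r.sharp = r.sharp ∘ₗ n.dualMap := by
    simpa only [rightInvTensor2_one, rightInvEnd_one] using h.comp_sharp 1
  have hR : rightTranslate I (1 : G) = LinearMap.id := LinearMap.ext rightTranslate_one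
  have htriv (v : GroupLieAlgebra I G) : rightTriv I (rightInvField I v) 1 = v :=
    rightTranslateInv_rightTranslate 1 v
  refine ⟨halt, fun α β γ ↦ ?_, fun v w ↦ ?_, hcomp, fun α β ↦ LinearMap.ext fun v ↦ ?_⟩
  · have := h.poisson 1 α β γ
    rw [schouten_rightInvTensor2 halt, hR, neg_eq_zero] at this
    exact this
  · have := h.nijenhuis (rightInvField I v) (rightInvField I w)
      (smoothVecAt_rightInvField v) (smoothVecAt_rightInvField w) 1
    rw [torsion_rightInvEnd n (smoothVecAt_rightInvField v 1) (smoothVecAt_rightInvField w 1),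
      htriv, htriv, rightTranslate_one, neg_eq_zero] at this
    exact this
  -- Constant functions to `𝔤*` give right-invariant forms, which extend prescribed covectors at the
  -- identity to global smooth test forms.
  · let e (α : Module.Dual ℝ E) : G → E →L[ℝ] ℝ := fun _ ↦ LinearMap.toContinuousLinearMap α
    have he (α : Module.Dual ℝ E) (g : G) : SmoothFormAt I (ofRightTrivForm I (e α)) g :=
      smoothFormAt_ofRightTrivForm contMDiffAt_const
    have := h.concomitant (ofRightTrivForm I (e α)) (ofRightTrivForm I (e β)) (he α) (he β)
      (rightInvField I v) (smoothVecAt_rightInvField v) 1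
    rw [concomitant_rightInv halt hcomp (he α 1) (he β 1) (smoothVecAt_rightInvField v 1),
      rightTrivForm_ofRightTrivForm, rightTrivForm_ofRightTrivForm, htriv, neg_eq_zero] at this
    exact this

end Group

end PNGroup

end

/-- The first part concerns the Lie algebra `𝔤 = T_e G`; in the converse, `𝔤` is any
finite-dimensional real Lie algebra and `φ` identifies it with the Lie algebra of `G`. -/
theorem proposition3p1
    {E : Type*} [NormedAddCommGroup E] [NormedSpace ℝ E] [FiniteDimensional ℝ E] [CompleteSpace E]
    {H : Type*} [TopologicalSpace H] (I : ModelWithCorners ℝ E H) [I.Boundaryless]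
    (G : Type*) [TopologicalSpace G] [ChartedSpace H G] [Group G] [LieGroup I ∞ G] :
    (∀ (P : PNGroup.Tensor2Field I G) (N : PNGroup.EndField I G),
      PNGroup.IsRightInvariantPN I P N →
        PNGroup.IsRNStructure (𝔤 := GroupLieAlgebra I G) (P 1) (N 1)) ∧
    (∀ (𝔤 : Type*) [LieRing 𝔤] [LieAlgebra ℝ 𝔤] [FiniteDimensional ℝ 𝔤]
      (φ : 𝔤 ≃ₗ⁅ℝ⁆ GroupLieAlgebra I G)
      (r : PNGroup.Tensor2 𝔤) (n : Module.End ℝ 𝔤),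
      PNGroup.IsRNStructure r n →
        PNGroup.IsRightInvariantPN I
          (PNGroup.rightInvTensor2 I
            (r.map ((φ : 𝔤 →ₗ⁅ℝ⁆ GroupLieAlgebra I G) : 𝔤 →ₗ[ℝ] GroupLieAlgebra I G)))
          (PNGroup.rightInvEnd I (φ.toLinearEquiv.conj n))) := by
  refine ⟨fun P N h ↦ ?_, fun 𝔤 _ _ _ φ r n h ↦ ?_⟩
  · obtain ⟨r, -, rfl⟩ := h.bivector_rightInv
    obtain ⟨n, rfl⟩ := h.end_rightInv
    rw [PNGroup.rightInvTensor2_one, PNGroup.rightInvEnd_one]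
    exact PNGroup.isRNStructure_of_isPoissonNijenhuis h.isPN
  · have h' := h.map φ
    exact ⟨h'.isPoissonNijenhuis, ⟨_, h'.alt, rfl⟩, ⟨_, rfl⟩⟩
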